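/- Throughout, $G$ is a non-compact, locally compact, Hausdorff, second countable topological group with left Haar measure $m$, and $G$ is amenable, i.e. $L^\infty(G,m)$ has a left-invariant mean. Let $G_0$ be the intersection of the kernels of all finite-dimensional continuous unitary representations of $G$. Let $\triangle$ be the modular function, normalised by $\triangle(g)\int |f(xg)|\,dm(x)=\int|f|\,dm$ for $f \in L^1(G,m)$. A two-sided Reiter sequence is a sequence $\Phi=(\Phi_N)$ of non-negative functions in $L^1(G,m)$, each of integral $1$, such that for every $g\in G$ $$\int|\Phi_N(g^{-1}x)-\Phi_N(x)|\,dm(x)\to0 \quad\text{and}\quad \int|\triangle(g)\Phi_N(xg)-\Phi_N(x)|\,dm(x)\to 0 \quad (N \to \infty).$$ A subset $S$ of $G$ is called substantial if $S\supseteq UWU$ for some symmetric open set $U\subseteq G$ containing the identity and some Borel set $W\subseteq G$ such that $\limsup_{N\to\infty}\int_W\Phi_N\,dm>0$ for some two-sided Reiter sequence $\Phi$. An increasing finite products set is a set of the form $$\{g_{k_1}g_{k_2}\cdots g_{k_r}\,:\, r\ge1,\ k_1<k_2<\dots<k_r \text{ in } \mathbb N\},$$ where $(g_n)_{n \in \mathbb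 N}$ is a sequence in $G$ that eventually leaves every compact subset of $G$. Theorem. Suppose that $G/G_0$ is compact, and let $S$ be a substantial subset of $G$. Then there are $a\in G$ and an increasing finite products set $P$ with $aP\subseteq S$, and there are $b\in G$ and an increasing finite products set $Q$ with $Qb\subseteq S$. -/

import Mathlib

open MeasureTheory Filter Topology
open scoped Pointwise ENNReal

noncomputable section

namespace FiniteProducts

section Group

variable {G : Type*} [Group G] [TopologicalSpace G]

/-- The von Neumann kernel `G₀`: the intersection of the kernels of all finite-dimensional
representations, i.e. of all continuous homomorphisms from `G` to a unitary group `U(n)`. -/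
def vonNeumannKernel (G : Type*) [Group G] [TopologicalSpace G] : Subgroup G :=
  ⨅ (n : ℕ) (ρ : G →ₜ* Matrix.unitaryGroup (Fin n) ℂ), ρ.toMonoidHom.ker

/-- `g_{k₁} ⋯ g_{kₘ}` for `α = {k₁ < ⋯ < kₘ}`. -/
def increasingProduct (g : ℕ → G) (α : Finset ℕ) : G :=
  ((α.sort (· ≤ ·)).map g).prod

/-- `P` is the increasing finite products set determined by some sequence in `G`
that eventually leaves every compact subset of `G`. -/
def IsIncreasingFiniteProductsSet (P : Set G) : Prop :=
  ∃ g : ℕ → G, Tendsto g atTop (cocompact G) ∧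
    P = {x | ∃ α : Finset ℕ, α.Nonempty ∧ x = increasingProduct g α}

/-- The modular function, normalised by `Δ(g) ∫ |f(xg)| dm(x) = ∫ |f(x)| dm(x)`.
Mathlib's `modularCharacter` uses the inverse normalisation. -/
def modularFunction [IsTopologicalGroup G] [LocallyCompactSpace G] (g : G) : ℝ :=
  ((Measure.modularCharacter g : NNReal) : ℝ)⁻¹

end Group

section Measure

variable {G : Type*} [Group G] [TopologicalSpace G] [IsTopologicalGroup G]
  [LocallyCompactSpace G] [MeasurableSpace G] [BorelSpace G]

/-- Left translation `(l_g f)(x) = f(g⁻¹x)` on `L^∞(G, m)`. -/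
def leftTranslate [SecondCountableTopology G] (m : Measure G) [m.IsHaarMeasure] (g : G)
    (f : Lp ℝ ∞ m) : Lp ℝ ∞ m :=
  Lp.compMeasurePreserving (fun x => g⁻¹ * x) (measurePreserving_mul_left m g⁻¹) f

/-- Amenability: `L^∞(G, m)` has a left-invariant mean. -/
def IsAmenable [SecondCountableTopology G] (m : Measure G) [m.IsHaarMeasure] : Prop :=
  ∃ M : Lp ℝ ∞ m →L[ℝ] ℝ,
    (∀ f, 0 ≤ f → 0 ≤ M f) ∧
    M ((memLp_top_const (1 : ℝ)).toLp (fun _ : G => (1 : ℝ))) = 1 ∧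
    ∀ (g : G) (f : Lp ℝ ∞ m), M (leftTranslate m g f) = M f

/-- A two-sided Reiter sequence: non-negative functions in `L¹(G, m)` of integral `1` with
`‖l_g Φ_N - Φ_N‖₁ → 0` and `‖Δ(g) r_g Φ_N - Φ_N‖₁ → 0` for every `g`, where
`(l_g f)(x) = f(g⁻¹x)` and `(r_g f)(x) = f(xg)`. -/
structure IsTwoSidedReiter (m : Measure G) (Φ : ℕ → G → ℝ) : Prop where
  nonneg : ∀ N x, 0 ≤ Φ N x
  integrable : ∀ N, Integrable (Φ N) m
  integral_eq_one : ∀ N, ∫ x, Φ N x ∂m = 1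
  left : ∀ g : G, Tendsto (fun N => ∫ x, |Φ N (g⁻¹ * x) - Φ N x| ∂m) atTop (𝓝 0)
  right : ∀ g : G,
    Tendsto (fun N => ∫ x, |modularFunction g * Φ N (x * g) - Φ N x| ∂m) atTop (𝓝 0)

/-- The upper density of `E` with respect to a Reiter sequence `Φ`. -/
def upperDensity (m : Measure G) (Φ : ℕ → G → ℝ) (E : Set G) : ℝ :=
  limsup (fun N => ∫ x in E, Φ N x ∂m) atTop

/-- `S` is substantial: `S ⊇ U W U` for some symmetric open neighbourhood `U` of the identity and
some measurable `W` with positive upper density along some two-sided Reiter sequence. -/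
def IsSubstantial (m : Measure G) (S : Set G) : Prop :=
  ∃ (W U : Set G) (Φ : ℕ → G → ℝ),
    MeasurableSet W ∧ IsTwoSidedReiter m Φ ∧ 0 < upperDensity m Φ W ∧
    IsOpen U ∧ U⁻¹ = U ∧ (1 : G) ∈ U ∧ U * W * U ⊆ S

end Measure

end FiniteProducts

end

/-!
The two-sided Reiter sequence gives a mean `M` on bounded measurable functions which is invariant
under left and right translations and does not vanish on `W` (`exists_mean_pos`).

Increasing products are built one factor at a time. If all products of `g₀, …, gₙ₋₁` with an
element of the support of `f` lie in the target set, and `g` is an element of that support, then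
`f · f(g · )` plays the role of `f` after `g` has been appended. So one has to find `g` in the
support of `f` with `M(f · f(g · )) > 0`. Completing a space of functions for the semi-inner product
`M(f h)` gives an orthogonal representation `ρ` of `G`, in which `M(f · f(g · )) = ⟨f, ρ(g) f⟩`. The
von Neumann kernel `G₀` acts trivially on every finite-dimensional invariant subspace, whence the
vectors orthogonal to the `G₀`-fixed ones are weakly mixing (`mean_inner_sq_eq_zero`): otherwise
averaging rank one operators over the orbit would give a nonzero compact operator commuting with
`ρ`, with finite-dimensional eigenspaces orthogonal to the `G₀`-fixed vectors. The `G₀`-fixed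
component of `f`, on the other hand, is nonzero and moves little under `V G₀` for a small
neighbourhood `V` of `1`. Hence `M(f · f(g · )) > 0` for most `g` in `V G₀`
(`exists_nhds_mean_mul_correlation_pos`).

It remains to find elements of the support of `f` in `V G₀`, where `V` depends on `f`. As `G ⧸ G₀`
is compact, the support of `f` has positive mean near some coset `k G₀`
(`exists_forall_mean_indicator_pos`). If the support of the initial function is close to `G₀`, the
representative `k` can be chosen in a given neighbourhood `U` of `1`, and a right translation by
`k⁻¹` moves the support to `G₀`; the neighbourhood `U` on the right of `W` absorbs it. The
neighbourhood on the left of `W` is only used once, to replace `W` by a function with uniformly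
continuous translates. The translate `a` or `b` in the theorem is what brings `W` close to `G₀` at
the start.
-/

namespace FiniteProducts

/-! ### Biinvariant means -/

/-- Bounded measurable real functions, the domain on which means are evaluated. -/
def IsBddMeasurable {G : Type*} [MeasurableSpace G] (f : G → ℝ) : Prop :=
  Measurable f ∧ ∃ C, ∀ x, |f x| ≤ C

namespace IsBddMeasurable

variable {G : Type*} [MeasurableSpace G] {f h : G → ℝ}

theorem const (c : ℝ) : IsBddMeasurable (fun _ : G => c) :=
  ⟨measurable_const, |c|, fun _ => le_rfl⟩

theorem add (hf : IsBddMeasurable f) (hh : IsBddMeasurable h) :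
    IsBddMeasurable (fun x => f x + h x) := by
  obtain ⟨mf, C, hC⟩ := hf
  obtain ⟨mh, D, hD⟩ := hh
  exact ⟨mf.add mh, C + D, fun x => (abs_add_le _ _).trans (add_le_add (hC x) (hD x))⟩

theorem mul (hf : IsBddMeasurable f) (hh : IsBddMeasurable h) :
    IsBddMeasurable (fun x => f x * h x) := by
  obtain ⟨mf, C, hC⟩ := hf
  obtain ⟨mh, D, hD⟩ := hh
  refine ⟨mf.mul mh, C * D, fun x => ?_⟩
  rw [abs_mul]
  exact mul_le_mul (hC x) (hD x) (abs_nonneg _) ((abs_nonneg _).trans (hC x))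

theorem const_mul (c : ℝ) (hf : IsBddMeasurable f) : IsBddMeasurable (fun x => c * f x) :=
  (const c).mul hf

theorem sub (hf : IsBddMeasurable f) (hh : IsBddMeasurable h) :
    IsBddMeasurable (fun x => f x - h x) := by
  simpa [sub_eq_add_neg] using hf.add (hh.const_mul (-1))

theorem abs (hf : IsBddMeasurable f) : IsBddMeasurable (fun x => |f x|) := by
  obtain ⟨mf, C, hC⟩ := hf
  exact ⟨by simpa using mf.norm, C, fun x => by simpa using hC x⟩

theorem sum {ι : Type*} (s : Finset ι) {F : ι → G → ℝ} (hF : ∀ i ∈ s, IsBddMeasurable (F i)) :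
    IsBddMeasurable (fun x => ∑ i ∈ s, F i x) := by
  classical
  induction s using Finset.induction_on with
  | empty => simpa using const (G := G) 0
  | insert a s ha ih =>
    simp only [Finset.sum_insert ha]
    exact (hF a (by simp)).add (ih fun i hi => hF i (by simp [hi]))

theorem indicator {E : Set G} (hE : MeasurableSet E) (hf : IsBddMeasurable f) :
    IsBddMeasurable (E.indicator f) := by
  obtain ⟨mf, C, hC⟩ := hf
  refine ⟨mf.indicator hE, C, fun x => ?_⟩
  by_cases hx : x ∈ E
  · simpa [hx] using hC x
  · simpa [hx] using (abs_nonneg _).trans (hC x)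

theorem comp {X : Type*} [MeasurableSpace X] {k : X → G} (hf : IsBddMeasurable f)
    (hk : Measurable k) : IsBddMeasurable (fun x => f (k x)) :=
  ⟨hf.1.comp hk, hf.2.imp fun _ hC x => hC (k x)⟩

end IsBddMeasurable

/-- A finitely additive mean on bounded measurable functions, invariant under left and right
translations. It is a total function whose values outside the bounded measurable functions carry
no information. -/
structure BiinvariantMean (G : Type*) [Group G] [MeasurableSpace G] where
  /-- The underlying functional. -/
  toFun : (G → ℝ) → ℝ
  add' : ∀ f h, IsBddMeasurable f → IsBddMeasurable h →
    toFun (fun x => f x + h x) = toFun f + toFun h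
  const_mul' : ∀ c f, IsBddMeasurable f → toFun (fun x => c * f x) = c * toFun f
  nonneg' : ∀ f, IsBddMeasurable f → (∀ x, 0 ≤ f x) → 0 ≤ toFun f
  one' : toFun (fun _ => 1) = 1
  left' : ∀ g f, IsBddMeasurable f → toFun (fun x => f (g * x)) = toFun f
  right' : ∀ g f, IsBddMeasurable f → toFun (fun x => f (x * g)) = toFun f

namespace BiinvariantMean

instance {G : Type*} [Group G] [MeasurableSpace G] :
    CoeFun (BiinvariantMean G) (fun _ => (G → ℝ) → ℝ) := ⟨toFun⟩

variable {G : Type*} [Group G] [MeasurableSpace G] (M : BiinvariantMean G) {f h : G → ℝ}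

theorem const (c : ℝ) : M (fun _ => c) = c := by
  simpa [M.one'] using M.const_mul' c _ (IsBddMeasurable.const 1)

theorem sub (hf : IsBddMeasurable f) (hh : IsBddMeasurable h) :
    M (fun x => f x - h x) = M f - M h := by
  have := M.add' f _ hf (hh.const_mul (-1))
  rw [M.const_mul' _ _ hh] at this
  simpa [sub_eq_add_neg] using this

theorem mono (hf : IsBddMeasurable f) (hh : IsBddMeasurable h) (hfh : ∀ x, f x ≤ h x) :
    M f ≤ M h := by
  have := M.nonneg' _ (hh.sub hf) fun x => sub_nonneg.2 (hfh x)
  rw [M.sub hh hf] at this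
  linarith

theorem le_of_forall_le (hf : IsBddMeasurable f) {C : ℝ} (hC : ∀ x, f x ≤ C) : M f ≤ C := by
  simpa [M.const] using M.mono hf (IsBddMeasurable.const C) hC

theorem abs_le (hf : IsBddMeasurable f) {C : ℝ} (hC : ∀ x, |f x| ≤ C) : |M f| ≤ C := by
  refine _root_.abs_le.2 ⟨?_, M.le_of_forall_le hf fun x => (le_abs_self _).trans (hC x)⟩
  simpa [M.const] using M.mono (IsBddMeasurable.const (-C)) hf fun x => (_root_.abs_le.1 (hC x)).1

theorem sum {ι : Type*} (s : Finset ι) {F : ι → G → ℝ} (hF : ∀ i ∈ s, IsBddMeasurable (F i)) :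
    M (fun x => ∑ i ∈ s, F i x) = ∑ i ∈ s, M (F i) := by
  classical
  induction s using Finset.induction_on with
  | empty => simpa using M.const 0
  | insert a s ha ih =>
    simp only [Finset.sum_insert ha]
    rw [M.add' _ _ (hF a (by simp)) (IsBddMeasurable.sum s fun i hi => hF i (by simp [hi])),
      ih fun i hi => hF i (by simp [hi])]

theorem exists_pos (hf : IsBddMeasurable f) (hM : 0 < M f) : ∃ x, 0 < f x := by
  by_contra! hc
  exact absurd (M.le_of_forall_le hf hc) (not_le.2 hM)

/-- A function whose square has mean zero has absolute value of mean zero. -/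
theorem abs_eq_zero_of_sq_eq_zero (hf : IsBddMeasurable f) (h0 : M (fun x => f x ^ 2) = 0) :
    M (fun x => |f x|) = 0 := by
  refine le_antisymm (le_of_forall_pos_le_add fun ε hε => ?_)
    (M.nonneg' _ hf.abs fun _ => abs_nonneg _)
  have hsq : IsBddMeasurable (fun x => f x ^ 2) := by simpa [sq] using hf.mul hf
  -- `|t| ≤ ε + t² / ε` trades the absolute value for the square.
  have key : M (fun x => |f x|) ≤ M (fun x => ε⁻¹ * f x ^ 2 + ε) := by
    refine M.mono hf.abs ((hsq.const_mul _).add (IsBddMeasurable.const _)) fun x => ?_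
    have h1 : ε * |f x| ≤ f x ^ 2 + ε * ε := by
      rw [← sq_abs]; nlinarith [sq_nonneg (|f x| - ε), abs_nonneg (f x)]
    have h2 : |f x| = ε⁻¹ * (ε * |f x|) := by field_simp
    calc |f x| = ε⁻¹ * (ε * |f x|) := h2
      _ ≤ ε⁻¹ * (f x ^ 2 + ε * ε) := by gcongr
      _ = _ := by field_simp
  rw [M.add' _ _ (hsq.const_mul _) (IsBddMeasurable.const _), M.const_mul' _ _ hsq, h0, M.const]
    at key
  linarith

section Topology

variable [TopologicalSpace G] [IsTopologicalGroup G] [T2Space G] [BorelSpace G]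
  [NoncompactSpace G]

/-- Compact sets are null: a non-compact group has arbitrarily many disjoint translates of one. -/
theorem indicator_compact_eq_zero {C : Set G} (hC : IsCompact C) :
    M (C.indicator fun _ => 1) = 0 := by
  have hb : ∀ D : Set G, IsCompact D → IsBddMeasurable (D.indicator fun _ => (1 : ℝ)) :=
    fun D hD => (IsBddMeasurable.const 1).indicator hD.isClosed.measurableSet
  have hn : ∀ n : ℕ, ∃ D : Set G, IsCompact D ∧
      n * M (C.indicator fun _ => 1) ≤ M (D.indicator fun _ => 1) := by
    intro n
    induction n with
    | zero => exact ⟨∅, isCompact_empty, by simpa using (M.const 0).ge⟩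
    | succ n ih =>
      obtain ⟨D, hD, hDn⟩ := ih
      obtain ⟨k, hk⟩ : ∃ k, k ∉ D * C⁻¹ := by
        by_contra! hc
        exact noncompact_univ G ((Set.eq_univ_of_forall hc) ▸ hD.mul hC.inv)
      -- `k C` is disjoint from `D` by the choice of `k`
      refine ⟨D ∪ (fun x => k * x) '' C, hD.union (hC.image (by fun_prop)), ?_⟩
      have hkC : IsCompact ((fun x => k * x) '' C) := hC.image (by fun_prop)
      have hdisj : Disjoint D ((fun x => k * x) '' C) := by
        rw [Set.disjoint_left]
        rintro _ hxD ⟨c, hc, rfl⟩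
        exact hk ⟨k * c, hxD, c⁻¹, by simpa using hc, by simp⟩
      have hs : ((D ∪ (fun x => k * x) '' C).indicator fun _ => (1 : ℝ)) =
          fun x => D.indicator (fun _ => 1) x + ((fun x => k * x) '' C).indicator (fun _ => 1) x :=
        Set.indicator_union_of_disjoint hdisj _
      have ht : M (((fun x => k * x) '' C).indicator fun _ => 1) = M (C.indicator fun _ => 1) := by
        rw [← M.left' k _ (hb _ hkC)]
        congr 1
        ext x
        have hiff : k * x ∈ (fun x => k * x) '' C ↔ x ∈ C :=
          ⟨fun ⟨y, hy, h⟩ => mul_left_cancel h ▸ hy, fun h => ⟨x, h, rfl⟩⟩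
        by_cases hx : x ∈ C
        · rw [Set.indicator_of_mem (hiff.2 hx), Set.indicator_of_mem hx]
        · rw [Set.indicator_of_notMem (hiff.not.2 hx), Set.indicator_of_notMem hx]
      rw [hs, M.add' _ _ (hb _ hD) (hb _ hkC), ht]
      push_cast
      linarith
  refine le_antisymm (not_lt.1 fun hpos => ?_) (M.nonneg' _ (hb C hC) fun x => ?_)
  · obtain ⟨n, hn'⟩ := exists_nat_gt (1 / M (C.indicator fun _ => 1))
    obtain ⟨D, hD, hDn⟩ := hn n
    have h1 : M (D.indicator fun _ => 1) ≤ 1 :=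
      M.le_of_forall_le (hb D hD) fun x => Set.indicator_le_self' (by simp) x
    rw [div_lt_iff₀ hpos] at hn'
    linarith
  · exact Set.indicator_nonneg (by simp) x

end Topology

end BiinvariantMean

/-! ### The mean of a Reiter sequence -/

theorem IsBddMeasurable.integrable_mul {G : Type*} [MeasurableSpace G] {m : Measure G}
    {f φ : G → ℝ} (hf : IsBddMeasurable f)
    (hφ : Integrable φ m) : Integrable (fun x => f x * φ x) m := by
  obtain ⟨mf, C, hC⟩ := hf
  exact hφ.bdd_mul mf.aestronglyMeasurable (Eventually.of_forall hC)

/-- Averages of a bounded function against two densities that become close in `L¹` become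
close. -/
theorem tendsto_integral_mul_sub {G : Type*} [MeasurableSpace G] {m : Measure G} {f : G → ℝ}
    (hf : IsBddMeasurable f) {Φ Ψ : ℕ → G → ℝ}
    (hΦ : ∀ N, Integrable (Φ N) m) (hΨ : ∀ N, Integrable (Ψ N) m)
    (h : Tendsto (fun N => ∫ x, |Ψ N x - Φ N x| ∂m) atTop (𝓝 0)) :
    Tendsto (fun N => (∫ x, f x * Ψ N x ∂m) - ∫ x, f x * Φ N x ∂m) atTop (𝓝 0) := by
  obtain ⟨C, hC⟩ := hf.2
  refine squeeze_zero_norm (fun N => ?_) (by simpa using h.const_mul C)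
  rw [← integral_sub (hf.integrable_mul (hΨ N)) (hf.integrable_mul (hΦ N)), ← integral_const_mul]
  refine norm_integral_le_of_norm_le ((((hΨ N).sub (hΦ N)).abs).const_mul C)
    (Eventually.of_forall fun x => ?_)
  rw [← mul_sub, norm_mul]
  exact mul_le_mul_of_nonneg_right (hC x) (norm_nonneg _)

section Reiter

variable {G : Type*} [Group G] [TopologicalSpace G] [IsTopologicalGroup G]
  [LocallyCompactSpace G] [SecondCountableTopology G] [MeasurableSpace G] [BorelSpace G]
  {m : Measure G} [m.IsHaarMeasure]

theorem integral_comp_mul_right (g : G) (f : G → ℝ) :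
    ∫ x, f x ∂m = modularFunction g * ∫ x, f (x * g) ∂m := by
  have h1 : ∫ x, f (x * g) ∂m = ∫ x, f x ∂(m.map (· * g)) :=
    ((MeasurableEquiv.mulRight g).measurableEmbedding.integral_map f).symm
  rw [h1, Measure.map_right_mul_eq_modularCharacterFun_smul, integral_smul_nnreal_measure]
  have h2 : ((Measure.modularCharacterFun g : NNReal) : ℝ) ≠ 0 := by
    exact_mod_cast (Measure.modularCharacterFun_pos g).ne'
  change _ = ((Measure.modularCharacterFun g : NNReal) : ℝ)⁻¹ *
    (((Measure.modularCharacterFun g : NNReal) : ℝ) * _)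
  field_simp

theorem integrable_comp_mul_right (g : G) {f : G → ℝ} (hf : Integrable f m) :
    Integrable (fun x => f (x * g)) m := by
  have h : Integrable f (m.map (· * g)) := by
    rw [Measure.map_right_mul_eq_modularCharacterFun_smul]
    exact hf.smul_measure_nnreal
  exact ((MeasurableEquiv.mulRight g).measurableEmbedding.integrable_map_iff).1 h

/-- A set of positive upper density has positive mean for some biinvariant mean: take the limit
of the averages along an ultrafilter on which the densities of the set stay away from zero. -/
theorem exists_mean_pos {Φ : ℕ → G → ℝ} (hΦ : IsTwoSidedReiter m Φ) {W : Set G}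
    (hW : MeasurableSet W) (hpos : 0 < upperDensity m Φ W) :
    ∃ M : BiinvariantMean G, 0 < M (W.indicator fun _ => 1) := by
  have hbound : ∀ f : G → ℝ, ∀ C, Measurable f → (∀ x, |f x| ≤ C) →
      ∀ N, |∫ x, f x * Φ N x ∂m| ≤ C := by
    intro f C mf hC N
    calc |∫ x, f x * Φ N x ∂m| ≤ ∫ x, C * Φ N x ∂m := by
          rw [← Real.norm_eq_abs]
          refine norm_integral_le_of_norm_le ((hΦ.integrable N).const_mul C)
            (Eventually.of_forall fun x => ?_)
          rw [norm_mul, Real.norm_of_nonneg (hΦ.nonneg N x)]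
          exact mul_le_mul_of_nonneg_right (hC x) (hΦ.nonneg N x)
      _ = C := by rw [integral_const_mul, hΦ.integral_eq_one, mul_one]
  have hWint : ∀ N, ∫ x, W.indicator (fun _ => (1 : ℝ)) x * Φ N x ∂m = ∫ x in W, Φ N x ∂m := by
    intro N
    rw [← integral_indicator hW]
    congr 1
    ext x
    by_cases hx : x ∈ W <;> simp [hx]
  obtain ⟨c, hc0, hc⟩ := exists_between hpos
  have hfreq : ∃ᶠ N in atTop, c < ∫ x in W, Φ N x ∂m := by
    refine frequently_lt_of_lt_limsup ?_ hc
    exact IsBoundedUnder.isCoboundedUnder_le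
      ⟨0, by simpa using ⟨0, fun N _ => integral_nonneg (hΦ.nonneg N)⟩⟩
  let l : Filter ℕ := atTop ⊓ 𝓟 {N | c < ∫ x in W, Φ N x ∂m}
  have hl : l.NeBot := frequently_mem_iff_neBot.1 hfreq
  let u : Ultrafilter ℕ := Ultrafilter.of l
  have hu : (u : Filter ℕ) ≤ atTop := (Ultrafilter.of_le l).trans inf_le_left
  have huc : ∀ᶠ N in (u : Filter ℕ), c < ∫ x in W, Φ N x ∂m :=
    (Ultrafilter.of_le l).trans inf_le_right (mem_principal_self _)
  have hlim : ∀ f : G → ℝ, IsBddMeasurable f →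
      Tendsto (fun N => ∫ x, f x * Φ N x ∂m) u
        (𝓝 (limUnder (u : Filter ℕ) fun N => ∫ x, f x * Φ N x ∂m)) := by
    rintro f ⟨mf, C, hC⟩
    obtain ⟨t, -, ht⟩ := (isCompact_Icc (a := -C) (b := C)).ultrafilter_le_nhds
      (u.map fun N => ∫ x, f x * Φ N x ∂m)
      (by
        rw [le_principal_iff]
        change ∀ᶠ N in (u : Filter ℕ), _ ∈ Set.Icc (-C) C
        exact Eventually.of_forall fun N => _root_.abs_le.1 (hbound f C mf hC N))
    exact tendsto_nhds_limUnder ⟨t, ht⟩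
  refine ⟨{ toFun := fun f => limUnder (u : Filter ℕ) fun N => ∫ x, f x * Φ N x ∂m
            add' := ?_, const_mul' := ?_, nonneg' := ?_, one' := ?_, left' := ?_, right' := ?_ }, ?_⟩
  · intro f h hf hh
    refine Tendsto.limUnder_eq (((hlim f hf).add (hlim h hh)).congr fun N => ?_)
    rw [← integral_add (hf.integrable_mul (hΦ.integrable N)) (hh.integrable_mul (hΦ.integrable N))]
    simp only [add_mul]
  · intro c f hf
    refine Tendsto.limUnder_eq (((hlim f hf).const_mul c).congr fun N => ?_)
    rw [← integral_const_mul]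
    simp only [mul_assoc]
  · intro f hf h0
    exact ge_of_tendsto' (hlim f hf) fun N =>
      integral_nonneg fun x => mul_nonneg (h0 x) (hΦ.nonneg N x)
  · refine Tendsto.limUnder_eq (tendsto_const_nhds.congr fun N => ?_)
    simp [hΦ.integral_eq_one N]
  · intro g f hf
    have h1 := tendsto_integral_mul_sub hf hΦ.integrable
      (fun N => (hΦ.integrable N).comp_mul_left g⁻¹) (hΦ.left g)
    refine Tendsto.limUnder_eq ?_
    simpa using ((h1.mono_left hu).add (hlim f hf)).congr fun N => by
      rw [sub_add_cancel, ← integral_mul_left_eq_self _ g]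
      simp
  · intro g f hf
    have h1 := tendsto_integral_mul_sub hf hΦ.integrable
      (fun N => (integrable_comp_mul_right g⁻¹ (hΦ.integrable N)).const_mul _) (hΦ.right g⁻¹)
    refine Tendsto.limUnder_eq ?_
    simpa using ((h1.mono_left hu).add (hlim f hf)).congr fun N => by
      rw [sub_add_cancel, integral_comp_mul_right g⁻¹ (fun x => f (x * g) * Φ N x),
        ← integral_const_mul]
      congr 1
      ext x
      simp only [inv_mul_cancel_right]
      ring
  · refine hc0.trans_le (ge_of_tendsto (hlim _ ((IsBddMeasurable.const 1).indicator hW)) ?_)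
    filter_upwards [huc] with N hN
    rw [hWint]
    exact hN.le

end Reiter

/-! ### Functions with uniformly continuous left translates -/

section RUC

variable {G : Type*} [Group G] [TopologicalSpace G] [IsTopologicalGroup G]

/-- Bounded functions that are uniformly continuous for the right uniform structure of `G`, i.e.
`f(g · ) → f` uniformly as `g → 1`. -/
def rucFunctions (G : Type*) [Group G] [TopologicalSpace G] [IsTopologicalGroup G] :
    Submodule ℝ (G → ℝ) where
  carrier := {f | (∃ C, ∀ x, |f x| ≤ C) ∧ ∀ ε > 0, ∀ᶠ g in 𝓝 (1 : G), ∀ x, |f (g * x) - f x| ≤ ε}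
  zero_mem' := ⟨⟨0, by simp⟩, fun ε hε => Eventually.of_forall fun g x => by simpa using hε.le⟩
  add_mem' := by
    rintro f h ⟨⟨C, hC⟩, hf⟩ ⟨⟨D, hD⟩, hh⟩
    refine ⟨⟨C + D, fun x => (abs_add_le _ _).trans (add_le_add (hC x) (hD x))⟩, fun ε hε => ?_⟩
    filter_upwards [hf _ (half_pos hε), hh _ (half_pos hε)] with g h1 h2 x
    calc |(f + h) (g * x) - (f + h) x| = |(f (g * x) - f x) + (h (g * x) - h x)| := by
          simp only [Pi.add_apply]; ring_nf
      _ ≤ ε / 2 + ε / 2 := (abs_add_le _ _).trans (add_le_add (h1 x) (h2 x))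
      _ = ε := add_halves ε
  smul_mem' := by
    rintro c f ⟨⟨C, hC⟩, hf⟩
    refine ⟨⟨|c| * C, fun x => ?_⟩, fun ε hε => ?_⟩
    · rw [Pi.smul_apply, smul_eq_mul, abs_mul]
      exact mul_le_mul_of_nonneg_left (hC x) (abs_nonneg c)
    · have hc : 0 < |c| + 1 := by positivity
      filter_upwards [hf _ (div_pos hε hc)] with g h1 x
      rw [Pi.smul_apply, Pi.smul_apply, smul_eq_mul, smul_eq_mul, ← mul_sub, abs_mul]
      calc |c| * |f (g * x) - f x| ≤ (|c| + 1) * (ε / (|c| + 1)) := by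
            gcongr
            · linarith
            · exact h1 x
        _ = ε := mul_div_cancel₀ ε hc.ne'

theorem const_mem_rucFunctions (c : ℝ) : (fun _ => c) ∈ rucFunctions G :=
  ⟨⟨|c|, fun _ => le_rfl⟩, fun ε hε => Eventually.of_forall fun g x => by simpa using hε.le⟩

theorem mul_mem_rucFunctions {f h : G → ℝ} (hf : f ∈ rucFunctions G) (hh : h ∈ rucFunctions G) :
    (fun x => f x * h x) ∈ rucFunctions G := by
  obtain ⟨⟨C, hC⟩, hf⟩ := hf
  obtain ⟨⟨D, hD⟩, hh⟩ := hh
  have hC0 : 0 ≤ C := (abs_nonneg _).trans (hC 1)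
  have hD0 : 0 ≤ D := (abs_nonneg _).trans (hD 1)
  refine ⟨⟨C * D, fun x => ?_⟩, fun ε hε => ?_⟩
  · rw [abs_mul]
    exact mul_le_mul (hC x) (hD x) (abs_nonneg _) hC0
  · have hk : 0 < C + D + 1 := by positivity
    filter_upwards [hf _ (div_pos hε hk), hh _ (div_pos hε hk)] with g h1 h2 x
    calc |f (g * x) * h (g * x) - f x * h x|
        = |f (g * x) * (h (g * x) - h x) + (f (g * x) - f x) * h x| := by ring_nf
      _ ≤ C * (ε / (C + D + 1)) + ε / (C + D + 1) * D := by
          refine (abs_add_le _ _).trans (add_le_add ?_ ?_) <;> rw [abs_mul]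
          · exact mul_le_mul (hC _) (h2 x) (abs_nonneg _) hC0
          · exact mul_le_mul (h1 x) (hD _) (abs_nonneg _) (by positivity)
      _ = (C + D) * (ε / (C + D + 1)) := by ring
      _ ≤ (C + D + 1) * (ε / (C + D + 1)) :=
        mul_le_mul_of_nonneg_right (by linarith) (by positivity)
      _ = ε := mul_div_cancel₀ ε hk.ne'

theorem comp_mul_left_mem_rucFunctions {f : G → ℝ} (hf : f ∈ rucFunctions G) (k : G) :
    (fun x => f (k * x)) ∈ rucFunctions G := by
  refine ⟨hf.1.imp fun C hC x => hC _, fun ε hε => ?_⟩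
  have hcont : Tendsto (fun g : G => k * g * k⁻¹) (𝓝 1) (𝓝 1) := by
    have : Continuous fun g : G => k * g * k⁻¹ := by fun_prop
    simpa using this.tendsto 1
  filter_upwards [hcont.eventually (hf.2 ε hε)] with g hg x
  simpa [mul_assoc] using hg (k * x)

theorem continuous_of_mem_rucFunctions {f : G → ℝ} (hf : f ∈ rucFunctions G) : Continuous f := by
  refine continuous_iff_continuousAt.2 fun x => Metric.tendsto_nhds.2 fun ε hε => ?_
  have hcont : Tendsto (fun y : G => y * x⁻¹) (𝓝 x) (𝓝 1) := by
    have : Continuous fun y : G => y * x⁻¹ := by fun_prop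
    simpa using this.tendsto x
  filter_upwards [hcont.eventually (hf.2 _ (half_pos hε))] with y hy
  have := hy x
  rw [inv_mul_cancel_right] at this
  exact this.trans_lt (half_lt_self hε)

theorem isBddMeasurable_of_mem_rucFunctions [MeasurableSpace G] [BorelSpace G] {f : G → ℝ}
    (hf : f ∈ rucFunctions G) : IsBddMeasurable f :=
  ⟨(continuous_of_mem_rucFunctions hf).measurable, hf.1⟩

/-- A set can be thickened on the left to a function in `rucFunctions G`: take
`x ↦ sup_{w ∈ W} ψ(x w⁻¹)` for a bump function `ψ` at `1`. -/
theorem exists_ruc_thickening [LocallyCompactSpace G] [T2Space G] (W : Set G) {U : Set G}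
    (hU : U ∈ 𝓝 (1 : G)) : ∃ f ∈ rucFunctions G, (∀ x, 0 ≤ f x) ∧ (∀ x ∈ W, 1 ≤ f x) ∧
      ∀ x, 0 < f x → x ∈ U * W := by
  rcases W.eq_empty_or_nonempty with rfl | ⟨w₀, hw₀⟩
  · exact ⟨fun _ => 0, const_mem_rucFunctions 0, by simp, by simp, by simp⟩
  have : Nonempty W := ⟨⟨w₀, hw₀⟩⟩
  obtain ⟨ψ, hψ1, hψ0, hψc, hψ⟩ := exists_continuous_one_zero_of_isCompact
    (isCompact_singleton (x := (1 : G))) (isOpen_interior (s := U)).isClosed_compl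
    (Set.disjoint_compl_right_iff_subset.2
      (Set.singleton_subset_iff.2 (mem_interior_iff_mem_nhds.2 hU)))
  have hψuc : ∀ ε > 0, ∀ᶠ g in 𝓝 (1 : G), ∀ x, |ψ (g * x) - ψ x| ≤ ε := by
    intro ε hε
    let _ : UniformSpace G := IsTopologicalGroup.rightUniformSpace G
    have : IsRightUniformGroup G := ⟨rfl⟩
    have huc := hψc.uniformContinuous_of_continuous ψ.continuous (Metric.dist_mem_uniformity hε)
    rw [mem_map, uniformity_eq_comap_nhds_one] at huc
    obtain ⟨N, hN, hsub⟩ := mem_comap.1 huc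
    filter_upwards [hN] with g hg x
    have hgx : dist (ψ x) (ψ (g * x)) < ε :=
      hsub (show ((x, g * x) : G × G).2 / ((x, g * x) : G × G).1 ∈ N by simpa using hg)
    rw [dist_comm] at hgx
    exact hgx.le
  have hbdd : ∀ x, BddAbove (Set.range fun w : W => ψ (x * (w : G)⁻¹)) := fun x =>
    ⟨1, by rintro _ ⟨w, rfl⟩; exact (hψ _).2⟩
  have hnonneg : ∀ x, 0 ≤ ⨆ w : W, ψ (x * (w : G)⁻¹) := fun x =>
    Real.iSup_nonneg fun w => (hψ _).1
  refine ⟨fun x => ⨆ w : W, ψ (x * (w : G)⁻¹), ⟨⟨1, fun x => ?_⟩, fun ε hε => ?_⟩, hnonneg,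
    fun x hx => ?_, fun x hx => ?_⟩
  · rw [abs_of_nonneg (hnonneg x)]
    exact ciSup_le fun w => (hψ _).2
  · filter_upwards [hψuc ε hε] with g hg x
    rw [abs_sub_le_iff, sub_le_iff_le_add, sub_le_iff_le_add]
    constructor <;> refine ciSup_le fun w => ?_
    · refine le_trans ?_ (add_le_add_right (le_ciSup (hbdd x) w) ε)
      have := (abs_sub_le_iff.1 (hg (x * (w : G)⁻¹))).1
      rw [← mul_assoc] at this
      linarith
    · refine le_trans ?_ (add_le_add_right (le_ciSup (hbdd (g * x)) w) ε)
      have := (abs_sub_le_iff.1 (hg (x * (w : G)⁻¹))).2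
      rw [← mul_assoc] at this
      linarith
  · refine le_trans ?_ (le_ciSup (hbdd x) ⟨x, hx⟩)
    rw [mul_inv_cancel, hψ1 (Set.mem_singleton 1), Pi.one_apply]
  · obtain ⟨w, hw⟩ := exists_lt_of_lt_ciSup hx
    refine ⟨x * (w : G)⁻¹, ?_, w, w.2, by simp⟩
    by_contra hxU
    exact hw.ne' (hψ0 fun hint => hxU (interior_subset hint))

end RUC

/-! ### The orthogonal representation attached to a mean -/

section GNS

variable {G : Type*} [Group G] [TopologicalSpace G] [IsTopologicalGroup G] [MeasurableSpace G]
  [BorelSpace G]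

/-- The space `rucFunctions G`, to be equipped with the semi-inner product `M(f h)`. -/
def PreGNS (_M : BiinvariantMean G) : Type _ := rucFunctions G

variable (M : BiinvariantMean G)

instance : AddCommGroup (PreGNS M) := inferInstanceAs (AddCommGroup (rucFunctions G))
instance : Module ℝ (PreGNS M) := inferInstanceAs (Module ℝ (rucFunctions G))

namespace PreGNS

variable {M}

theorem isBddMeasurable (f : PreGNS M) : IsBddMeasurable f.1 :=
  isBddMeasurable_of_mem_rucFunctions f.2

variable (M) in
/-- The semi-inner product `⟨f, h⟩ = M(f h)`. -/
noncomputable abbrev core : PreInnerProductSpace.Core ℝ (PreGNS M) where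
  inner f h := M fun x => f.1 x * h.1 x
  conj_inner_symm f h := by simp [mul_comm]
  re_inner_nonneg f := M.nonneg' _ (f.isBddMeasurable.mul f.isBddMeasurable) fun x =>
    mul_self_nonneg _
  add_left f h k := by
    rw [← M.add' _ _ (f.isBddMeasurable.mul k.isBddMeasurable)
      (h.isBddMeasurable.mul k.isBddMeasurable)]
    congr 1
    ext x
    exact add_mul _ _ _
  smul_left f h c := by
    change _ = c * M _
    rw [← M.const_mul' _ _ (f.isBddMeasurable.mul h.isBddMeasurable)]
    congr 1
    ext x
    exact mul_assoc _ _ _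

noncomputable instance : SeminormedAddCommGroup (PreGNS M) :=
  @InnerProductSpace.Core.toSeminormedAddCommGroup ℝ _ _ _ _ (core M)

noncomputable instance : InnerProductSpace ℝ (PreGNS M) := InnerProductSpace.ofCore (core M)

theorem inner_def (f h : PreGNS M) : inner ℝ f h = M fun x => f.1 x * h.1 x := rfl

theorem norm_le {f : PreGNS M} {C : ℝ} (hC0 : 0 ≤ C) (hC : ∀ x, |f.1 x| ≤ C) : ‖f‖ ≤ C := by
  refine abs_le_of_sq_le_sq' ?_ hC0 |>.2
  rw [← real_inner_self_eq_norm_sq, inner_def]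
  refine M.le_of_forall_le (f.isBddMeasurable.mul f.isBddMeasurable) fun x => ?_
  rw [← sq]
  exact sq_le_sq' (abs_le.1 (hC x)).1 (abs_le.1 (hC x)).2

/-- Left translation `f ↦ f(g⁻¹ · )` as a linear map. -/
def translate (g : G) : PreGNS M →ₗ[ℝ] PreGNS M where
  toFun f := ⟨fun x => f.1 (g⁻¹ * x), comp_mul_left_mem_rucFunctions f.2 g⁻¹⟩
  map_add' _ _ := rfl
  map_smul' _ _ := rfl

theorem inner_translate (g : G) (f h : PreGNS M) :
    inner ℝ (translate g f) (translate g h) = inner ℝ f h :=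
  M.left' g⁻¹ (fun x => f.1 x * h.1 x) (f.isBddMeasurable.mul h.isBddMeasurable)

theorem norm_translate (g : G) (f : PreGNS M) : ‖translate g f‖ = ‖f‖ := by
  rw [@norm_eq_sqrt_real_inner, @norm_eq_sqrt_real_inner, inner_translate]

/-- Left translation as a continuous linear map. -/
noncomputable def translateL (g : G) : PreGNS M →L[ℝ] PreGNS M :=
  (translate g).mkContinuous 1 fun f => by rw [norm_translate, one_mul]

end PreGNS

/-- The Hilbert space attached to a mean. -/
abbrev GNS (M : BiinvariantMean G) : Type _ := UniformSpace.Completion (PreGNS M)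

variable {H : Type*} [NormedAddCommGroup H] [InnerProductSpace ℝ H]

/-- A strongly continuous orthogonal representation of `G` on a real inner product space. -/
structure IsOrthogonalRep {G : Type*} [Group G] [TopologicalSpace G] (ρ : G →* (H →L[ℝ] H)) :
    Prop where
  inner_map : ∀ g x y, inner ℝ (ρ g x) (ρ g y) = inner ℝ x y
  continuous_apply : ∀ x, Continuous fun g => ρ g x

namespace PreGNS

variable {M}

/-- The representation of `G` by left translations on the completion. -/
noncomputable def rep : G →* (GNS M →L[ℝ] GNS M) where
  toFun g := (translateL g).completion
  map_one' := by
    ext x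
    induction x using UniformSpace.Completion.induction_on with
    | hp => exact isClosed_eq (by fun_prop) (by fun_prop)
    | ih f =>
      rw [ContinuousLinearMap.completion_apply_coe]
      congr 1
      apply Subtype.ext
      ext x
      change f.1 (1⁻¹ * x) = f.1 x
      simp
  map_mul' g h := by
    ext x
    induction x using UniformSpace.Completion.induction_on with
    | hp => exact isClosed_eq (by fun_prop) (by fun_prop)
    | ih f =>
      rw [mul_apply_eq_comp, ContinuousLinearMap.completion_apply_coe,
        ContinuousLinearMap.completion_apply_coe, ContinuousLinearMap.completion_apply_coe]
      congr 1
      apply Subtype.ext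
      ext x
      change f.1 ((g * h)⁻¹ * x) = f.1 (h⁻¹ * (g⁻¹ * x))
      simp [mul_assoc]

theorem rep_coe (g : G) (f : PreGNS M) :
    rep g (f : GNS M) = (translate g f : PreGNS M) :=
  ContinuousLinearMap.completion_apply_coe _ _

theorem isOrthogonalRep_rep : IsOrthogonalRep (rep (M := M)) := by
  have hinner : ∀ (g : G) (x y : GNS M),
      inner ℝ (rep g x) (rep g y) = inner ℝ x y := by
    intro g x y
    induction x, y using UniformSpace.Completion.induction_on₂ with
    | hp => exact isClosed_eq (by fun_prop) (by fun_prop)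
    | ih f h =>
      rw [rep_coe, rep_coe, UniformSpace.Completion.inner_coe, UniformSpace.Completion.inner_coe,
        inner_translate]
  refine ⟨hinner, fun x => ?_⟩
  have hnorm : ∀ (g : G) (x : GNS M), ‖rep g x‖ = ‖x‖ := fun g x => by
    rw [@norm_eq_sqrt_real_inner, @norm_eq_sqrt_real_inner, hinner]
  -- Strong continuity at `1` on the dense subspace is uniform continuity of the functions.
  have hone : ∀ x : GNS M, Tendsto (fun g => rep g x) (𝓝 1) (𝓝 x) := by
    intro x
    refine Metric.tendsto_nhds.2 fun ε hε => ?_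
    obtain ⟨f, hf⟩ := (UniformSpace.Completion.denseRange_coe (α := PreGNS M)).exists_dist_lt x
      (show 0 < ε / 3 by positivity)
    have hinv : Tendsto (fun g : G => g⁻¹) (𝓝 1) (𝓝 1) := by
      simpa using (continuous_inv (G := G)).tendsto 1
    filter_upwards [hinv.eventually (f.2.2 (ε / 4) (by positivity))] with g hg
    have h1 : dist (rep g x) (rep g f) < ε / 3 := by
      rwa [dist_eq_norm, ← map_sub, hnorm, ← dist_eq_norm]
    have h2 : dist (rep g (f : GNS M)) f ≤ ε / 4 := by
      rw [rep_coe, UniformSpace.Completion.dist_eq, dist_eq_norm]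
      exact norm_le (by positivity) hg
    calc dist (rep g x) x
        ≤ dist (rep g x) (rep g f) + dist (rep g (f : GNS M)) f + dist (f : GNS M) x :=
          dist_triangle4 _ _ _ _
      _ < ε := by rw [dist_comm (f : GNS M) x]; linarith
  refine continuous_iff_continuousAt.2 fun g₀ => ?_
  have hcont : Tendsto (fun g : G => g₀⁻¹ * g) (𝓝 g₀) (𝓝 1) := by
    have : Continuous fun g : G => g₀⁻¹ * g := by fun_prop
    simpa using this.tendsto g₀
  have h := ((rep g₀).continuous.tendsto x).comp ((hone x).comp hcont)
  refine h.congr fun g => ?_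
  simp only [Function.comp_apply]
  rw [← mul_apply_eq_comp, ← map_mul, mul_inv_cancel_left]

end PreGNS

end GNS

/-! ### Compactness of positive operators of finite trace -/

section Compact

variable {H : Type*} [NormedAddCommGroup H] [InnerProductSpace ℝ H]

theorem orthonormal_cons {n : ℕ} {e : Fin n → H} (he : Orthonormal ℝ e) {y : H} (hy : ‖y‖ = 1)
    (hye : ∀ i, inner ℝ (e i) y = 0) : Orthonormal ℝ (Fin.cons y e : Fin (n + 1) → H) := by
  refine ⟨fun i => ?_, fun i j hij => ?_⟩
  · refine Fin.cases ?_ (fun i => ?_) i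
    · simpa using hy
    · simpa using he.1 i
  · induction i using Fin.cases with
    | zero =>
      induction j using Fin.cases with
      | zero => exact absurd rfl hij
      | succ j => simpa [real_inner_comm] using hye j
    | succ i =>
      induction j using Fin.cases with
      | zero => simpa using hye i
      | succ j => simpa using he.2 (fun h => hij (congrArg Fin.succ h))

/-- A positive operator whose diagonal sums over orthonormal families are bounded is compact: on
the complement of a nearly optimal finite family the quadratic form, and with it the operator, is
small. -/
theorem isCompactOperator_of_sum_inner_le [CompleteSpace H] {T : H →L[ℝ] H}
    (hsymm : ∀ x y, inner ℝ (T x) y = inner ℝ x (T y))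
    (hpos : ∀ x, 0 ≤ inner ℝ (T x) x) {C : ℝ}
    (hC : ∀ (n : ℕ) (e : Fin n → H), Orthonormal ℝ e → ∑ i, inner ℝ (T (e i)) (e i) ≤ C) :
    IsCompactOperator T := by
  let A : Set ℝ := {t | ∃ (n : ℕ) (e : Fin n → H), Orthonormal ℝ e ∧
    t = ∑ i, inner ℝ (T (e i)) (e i)}
  have hAbdd : BddAbove A := ⟨C, by rintro _ ⟨n, e, he, rfl⟩; exact hC n e he⟩
  have hAne : A.Nonempty := ⟨_, 0, Fin.elim0, ⟨fun i => i.elim0, fun i => i.elim0⟩, rfl⟩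
  -- Cauchy-Schwarz for the positive semidefinite form `⟨T x, y⟩`.
  have hCS : ∀ x, ‖T x‖ ^ 2 ≤ ‖T‖ * inner ℝ (T x) x := by
    intro x
    have h1 := LinearMap.BilinForm.apply_mul_apply_le_of_forall_zero_le
      ((innerₗ H).comp T.toLinearMap) hpos x (T x)
    have h2 : inner ℝ (T (T x)) (T x) ≤ ‖T‖ * ‖T x‖ ^ 2 := by
      calc inner ℝ (T (T x)) (T x) ≤ ‖T (T x)‖ * ‖T x‖ := real_inner_le_norm _ _
        _ ≤ ‖T‖ * ‖T x‖ * ‖T x‖ := by gcongr; exact T.le_opNorm _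
        _ = _ := by ring
    have h3 : ‖T x‖ ^ 2 * ‖T x‖ ^ 2 ≤ inner ℝ (T x) x * (‖T‖ * ‖T x‖ ^ 2) := by
      refine le_trans ?_ (mul_le_mul_of_nonneg_left h2 (hpos x))
      have h4 : inner ℝ (T x) (T x) * inner ℝ (T (T x)) x ≤
        inner ℝ (T x) x * inner ℝ (T (T x)) (T x) := h1
      rwa [hsymm (T x) x, real_inner_self_eq_norm_sq] at h4
    rcases eq_or_ne (T x) 0 with h0 | h0
    · simp [h0]
    · have h5 : 0 < ‖T x‖ ^ 2 := by positivity
      nlinarith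
  have happrox : ∀ ε > 0, ∃ F : H →L[ℝ] H, IsCompactOperator F ∧ ‖F - T‖ ≤ ε := by
    intro ε hε
    have hδ : 0 < ε ^ 2 / (‖T‖ + 1) := by positivity
    obtain ⟨_, ⟨n, e, he, rfl⟩, hlt⟩ := exists_lt_of_lt_csSup hAne (sub_lt_self (sSup A) hδ)
    let K : Submodule ℝ H := Submodule.span ℝ (Set.range e)
    have hKfin : FiniteDimensional ℝ K := FiniteDimensional.span_of_finite ℝ (Set.finite_range e)
    refine ⟨T.comp K.starProjection, ?_, ?_⟩
    · have hKc : IsCompactOperator (T.comp K.subtypeL : K →L[ℝ] H) := by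
        have : ProperSpace K := FiniteDimensional.proper ℝ K
        exact isCompactOperator_of_locallyCompactSpace_rng (M₂ := K) _
      exact hKc.comp_clm K.orthogonalProjectionOnto
    have hq : ∀ y ∈ Kᗮ, inner ℝ (T y) y ≤ ε ^ 2 / (‖T‖ + 1) * ‖y‖ ^ 2 := by
      intro y hy
      rcases eq_or_ne y 0 with rfl | hy0
      · simp
      have hyn : 0 < ‖y‖ := norm_pos_iff.2 hy0
      have hon := orthonormal_cons he (y := ‖y‖⁻¹ • y)
        (by rw [norm_smul, norm_inv, norm_norm, inv_mul_cancel₀ hyn.ne'])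
        (fun i => by
          rw [inner_smul_right, (Submodule.mem_orthogonal K y).1 hy _
            (Submodule.subset_span (Set.mem_range_self i)), mul_zero])
      have hle := le_csSup hAbdd ⟨_, _, hon, rfl⟩
      rw [Fin.sum_univ_succ] at hle
      simp only [Fin.cons_zero, Fin.cons_succ, map_smul, inner_smul_left, inner_smul_right,
        RCLike.conj_to_real] at hle
      have h1 : ‖y‖⁻¹ * (‖y‖⁻¹ * inner ℝ (T y) y) ≤ ε ^ 2 / (‖T‖ + 1) := by linarith
      calc inner ℝ (T y) y = ‖y‖⁻¹ * (‖y‖⁻¹ * inner ℝ (T y) y) * ‖y‖ ^ 2 := by field_simp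
        _ ≤ _ := by gcongr
    refine ContinuousLinearMap.opNorm_le_bound _ hε.le fun x => ?_
    have hy : x - K.starProjection x ∈ Kᗮ := K.sub_starProjection_mem_orthogonal x
    have hyx : ‖x - K.starProjection x‖ ≤ ‖x‖ := by
      have h1 := Submodule.norm_sq_eq_add_norm_sq_starProjection x K
      have h2 : Kᗮ.starProjection x = x - K.starProjection x := by
        rw [Submodule.starProjection_orthogonal']; rfl
      rw [h2] at h1
      nlinarith [sq_nonneg ‖K.starProjection x‖, norm_nonneg x,
        norm_nonneg (x - K.starProjection x)]
    have hrw : (T.comp K.starProjection - T) x = -T (x - K.starProjection x) := by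
      simp [map_sub]
    rw [hrw, norm_neg]
    refine le_trans ?_ (mul_le_mul_of_nonneg_left hyx hε.le)
    refine abs_le_of_sq_le_sq' ?_ (by positivity) |>.2
    calc ‖T (x - K.starProjection x)‖ ^ 2
        ≤ ‖T‖ * (ε ^ 2 / (‖T‖ + 1) * ‖x - K.starProjection x‖ ^ 2) :=
          (hCS _).trans (mul_le_mul_of_nonneg_left (hq _ hy) (norm_nonneg _))
      _ = ‖T‖ / (‖T‖ + 1) * (ε * ‖x - K.starProjection x‖) ^ 2 := by ring
      _ ≤ 1 * (ε * ‖x - K.starProjection x‖) ^ 2 := by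
          gcongr
          exact div_le_one_of_le₀ (by linarith) (by positivity)
      _ = _ := one_mul _
  have hmem : T ∈ closure {F : H →L[ℝ] H | IsCompactOperator F} := by
    refine Metric.mem_closure_iff.2 fun ε hε => ?_
    obtain ⟨F, hF, hFT⟩ := happrox (ε / 2) (half_pos hε)
    exact ⟨F, hF, by rw [dist_comm, dist_eq_norm]; linarith⟩
  rwa [isClosed_setOfPred_isCompactOperator.closure_eq] at hmem

end Compact

/-! ### Orthogonal representations and the von Neumann kernel -/

section Rep

variable {G : Type*} [Group G] [TopologicalSpace G]

instance vonNeumannKernel_normal : (vonNeumannKernel G).Normal :=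
  Subgroup.normal_iInf_normal fun _ => Subgroup.normal_iInf_normal fun _ =>
    MonoidHom.normal_ker _

variable {H : Type*} [NormedAddCommGroup H] [InnerProductSpace ℝ H] {ρ : G →* (H →L[ℝ] H)}

theorem rep_mul_apply {G : Type*} [Group G] (ρ : G →* (H →L[ℝ] H)) (g h : G) (x : H) :
    ρ (g * h) x = ρ g (ρ h x) := by
  rw [map_mul, mul_apply_eq_comp]

namespace IsOrthogonalRep

theorem norm_map (hρ : IsOrthogonalRep ρ) (g : G) (x : H) : ‖ρ g x‖ = ‖x‖ := by
  rw [@norm_eq_sqrt_real_inner, @norm_eq_sqrt_real_inner, hρ.inner_map]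

theorem inner_map_left (hρ : IsOrthogonalRep ρ) (g : G) (x y : H) :
    inner ℝ (ρ g x) y = inner ℝ x (ρ g⁻¹ y) := by
  rw [← hρ.inner_map g x, ← rep_mul_apply ρ, mul_inv_cancel, map_one]; rfl

/-- The von Neumann kernel acts trivially on finite-dimensional invariant subspaces: in an
orthonormal basis such a subspace gives a homomorphism into a unitary group. -/
theorem apply_eq_self_of_finiteDimensional (hρ : IsOrthogonalRep ρ) (F : Submodule ℝ H)
    [FiniteDimensional ℝ F] (hF : ∀ g, ∀ x ∈ F, ρ g x ∈ F) {z : G}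
    (hz : z ∈ vonNeumannKernel G) {x : H} (hx : x ∈ F) : ρ z x = x := by
  let b := stdOrthonormalBasis ℝ F
  let r : G → F →ₗ[ℝ] F := fun g => (ρ g).toLinearMap.restrict (hF g)
  have hr1 : r 1 = LinearMap.id := by
    ext x
    change ρ 1 (x : H) = x
    rw [map_one]; rfl
  have hrmul : ∀ g h, r (g * h) = r g ∘ₗ r h := fun g h => by
    ext x
    exact rep_mul_apply ρ g h x
  let A : G → Matrix _ _ ℂ := fun g =>
    (LinearMap.toMatrix b.toBasis b.toBasis (r g)).map Complex.ofRealHom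
  have hA : ∀ g i j, A g i j = ((inner ℝ (b i : H) (ρ g (b j)) : ℝ) : ℂ) := by
    intro g i j
    simp only [A, Matrix.map_apply, LinearMap.toMatrix_apply, OrthonormalBasis.coe_toBasis,
      OrthonormalBasis.coe_toBasis_repr_apply, OrthonormalBasis.repr_apply_apply]
    rfl
  have hA1 : A 1 = 1 := by
    simp only [A, hr1, LinearMap.toMatrix_id]
    exact Matrix.map_one _ (map_zero _) (map_one _)
  have hAmul : ∀ g h, A (g * h) = A g * A h := fun g h => by
    simp only [A, hrmul, LinearMap.toMatrix_comp b.toBasis b.toBasis b.toBasis]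
    exact Matrix.map_mul
  have hAstar : ∀ g, star (A g) = A g⁻¹ := fun g => by
    ext i j
    rw [Matrix.star_apply, hA, hA, ← hρ.inner_map_left, real_inner_comm]
    simp
  have hAu : ∀ g, A g ∈ Matrix.unitaryGroup _ ℂ := fun g => by
    rw [Matrix.mem_unitaryGroup_iff, hAstar, ← hAmul, mul_inv_cancel, hA1]
  let σ : G →ₜ* Matrix.unitaryGroup (Fin (Module.finrank ℝ F)) ℂ :=
    { toFun := fun g => ⟨A g, hAu g⟩
      map_one' := Subtype.ext hA1
      map_mul' := fun g h => Subtype.ext (hAmul g h)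
      continuous_toFun := by
        refine Continuous.subtype_mk (continuous_matrix fun i j => ?_) _
        simp only [hA]
        exact Complex.continuous_ofReal.comp
          (continuous_const.inner (hρ.continuous_apply _)) }
  have hσ : σ z = 1 := by
    have := (Subgroup.mem_iInf.1 ((Subgroup.mem_iInf.1 hz) _)) σ
    exact this
  have hAz : A z = A 1 := by rw [hA1]; exact congrArg Subtype.val hσ
  have hrz : r z = r 1 :=
    (LinearMap.toMatrix b.toBasis b.toBasis).injective
      (Matrix.map_injective Complex.ofReal_injective hAz)
  have := congrArg Subtype.val (LinearMap.congr_fun hrz ⟨x, hx⟩)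
  rw [hr1] at this
  exact this

variable [MeasurableSpace G] [BorelSpace G]

theorem isBddMeasurable_inner (hρ : IsOrthogonalRep ρ) (η ξ : H) :
    IsBddMeasurable fun g => inner ℝ η (ρ g ξ) :=
  ⟨(continuous_const.inner (hρ.continuous_apply ξ)).measurable, ‖η‖ * ‖ξ‖, fun g => by
    simpa [hρ.norm_map] using abs_real_inner_le_norm η (ρ g ξ)⟩

/-- Vectors orthogonal to the fixed vectors of the von Neumann kernel are weakly mixing. The mean
over `g` of the rank one operators `ρ(g)ξ ⊗ ρ(g)ξ` is a positive operator commuting with `ρ`, of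
trace at most `‖ξ‖²`, hence compact. Its eigenspaces for nonzero eigenvalues are
finite-dimensional and invariant, so they consist of vectors fixed by the kernel, and these are
orthogonal to the orbit of `ξ`. -/
theorem mean_inner_sq_eq_zero [CompleteSpace H] (hρ : IsOrthogonalRep ρ) (M : BiinvariantMean G)
    {ξ : H} (hξ : ∀ y, (∀ z ∈ vonNeumannKernel G, ρ z y = y) → inner ℝ y ξ = 0) (η : H) :
    M (fun g => inner ℝ η (ρ g ξ) ^ 2) = 0 := by
  let c : H → G → ℝ := fun η g => inner ℝ η (ρ g ξ)
  have hc : ∀ η, IsBddMeasurable (c η) := fun η => hρ.isBddMeasurable_inner η ξ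
  have hcle : ∀ η g, |c η g| ≤ ‖η‖ * ‖ξ‖ := fun η g => by
    simpa [hρ.norm_map] using abs_real_inner_le_norm η (ρ g ξ)
  have hcadd : ∀ η η' g, c (η + η') g = c η g + c η' g := fun η η' g => inner_add_left _ _ _
  have hcsmul : ∀ (t : ℝ) η g, c (t • η) g = t * c η g := fun t η g => real_inner_smul_left _ _ _
  let B₀ : H →ₗ[ℝ] H →ₗ[ℝ] ℝ := LinearMap.mk₂ ℝ (fun η η' => M fun g => c η g * c η' g)
    (fun η₁ η₂ η' => by
      rw [← M.add' _ _ ((hc _).mul (hc _)) ((hc _).mul (hc _))]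
      simp only [hcadd, add_mul])
    (fun t η η' => by
      rw [smul_eq_mul, ← M.const_mul' _ _ ((hc _).mul (hc _))]
      simp only [hcsmul, mul_assoc])
    (fun η η₁ η₂ => by
      rw [← M.add' _ _ ((hc _).mul (hc _)) ((hc _).mul (hc _))]
      simp only [hcadd, mul_add])
    (fun t η η' => by
      rw [smul_eq_mul, ← M.const_mul' _ _ ((hc _).mul (hc _))]
      simp only [hcsmul, mul_left_comm])
  let B : H →L[ℝ] H →L[ℝ] ℝ := B₀.mkContinuous₂ (‖ξ‖ ^ 2) fun η η' => by
    refine M.abs_le ((hc η).mul (hc η')) fun g => ?_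
    calc |c η g * c η' g| = |c η g| * |c η' g| := abs_mul _ _
      _ ≤ (‖η‖ * ‖ξ‖) * (‖η'‖ * ‖ξ‖) :=
        mul_le_mul (hcle _ _) (hcle _ _) (abs_nonneg _) (by positivity)
      _ = _ := by ring
  let T : H →L[ℝ] H := InnerProductSpace.continuousLinearMapOfBilin (𝕜 := ℝ) B
  have hT : ∀ η η', inner ℝ (T η) η' = M fun g => c η g * c η' g := fun η η' =>
    InnerProductSpace.continuousLinearMapOfBilin_apply (𝕜 := ℝ) B η η'
  have hsymm : ∀ x y, inner ℝ (T x) y = inner ℝ x (T y) := fun x y => by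
    rw [hT, real_inner_comm, hT]
    simp only [mul_comm]
  have hcomm : ∀ g x, T (ρ g x) = ρ g (T x) := by
    intro g x
    refine ext_inner_right ℝ fun w => ?_
    rw [hρ.inner_map_left, hT, hT, ← M.left' g _ ((hc _).mul (hc _))]
    congr 1
    ext h
    simp only [c]
    rw [rep_mul_apply ρ, hρ.inner_map, real_inner_comm _ (ρ g⁻¹ w), ← hρ.inner_map g (ρ h ξ),
      ← rep_mul_apply ρ g g⁻¹, mul_inv_cancel, map_one]
    exact congrArg _ (real_inner_comm _ _)
  have hcompact : IsCompactOperator T := by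
    refine isCompactOperator_of_sum_inner_le hsymm (fun x => ?_) (C := ‖ξ‖ ^ 2) fun n e he => ?_
    · rw [hT]
      exact M.nonneg' _ ((hc x).mul (hc x)) fun g => mul_self_nonneg _
    · simp only [hT]
      rw [← M.sum Finset.univ fun i _ => (hc (e i)).mul (hc (e i))]
      refine M.le_of_forall_le (IsBddMeasurable.sum _ fun i _ => (hc _).mul (hc _)) fun g => ?_
      have := he.sum_inner_products_le (ρ g ξ) (s := Finset.univ)
      rw [hρ.norm_map] at this
      simpa [c, ← sq] using this
  have hT0 : T = 0 := by
    refine (ContinuousLinearMap.eq_zero_of_forall_hasEigenvalue_eq_zero hcompact hsymm).1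
      fun μ hμ => ?_
    by_contra hμ0
    have hfin := ContinuousLinearMap.finite_dimensional_eigenspace hcompact μ hμ0
    obtain ⟨x, hx⟩ := hμ.exists_hasEigenvector
    have hinv : ∀ g, ∀ y ∈ Module.End.eigenspace T.toLinearMap μ,
        ρ g y ∈ Module.End.eigenspace T.toLinearMap μ := by
      intro g y hy
      have hy' : T y = μ • y := Module.End.mem_eigenspace_iff.1 hy
      refine Module.End.mem_eigenspace_iff.2 ?_
      change T (ρ g y) = μ • ρ g y
      rw [hcomm, hy', map_smul]
    have hc0 : ∀ g, c x g = 0 := fun g => by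
      simp only [c]
      rw [real_inner_comm, hρ.inner_map_left, real_inner_comm]
      exact hξ _ fun z hz => hρ.apply_eq_self_of_finiteDimensional _ hinv hz (hinv _ x hx.1)
    have h1 : inner ℝ (T x) x = 0 := by
      rw [hT]
      simp only [hc0, mul_zero]
      exact M.const 0
    have h2 : T x = μ • x := hx.apply_eq_smul
    rw [h2, real_inner_smul_left, mul_eq_zero, inner_self_eq_zero] at h1
    exact h1.elim hμ0 hx.2
  have := hT η η
  rw [hT0] at this
  simpa [c, ← sq] using this.symm

end IsOrthogonalRep

end Rep

/-! ### Return times near the von Neumann kernel -/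

/-- If `G ⧸ N` is compact, a function of positive mean has positive mean on the preimages of all
neighbourhoods of some point of `G ⧸ N`. -/
theorem exists_forall_mean_indicator_pos {G : Type*} [Group G] [TopologicalSpace G]
    [MeasurableSpace G] [BorelSpace G] (M : BiinvariantMean G) (N : Subgroup G)
    [CompactSpace (G ⧸ N)] {f : G → ℝ} (hf : IsBddMeasurable f) (h0 : ∀ x, 0 ≤ f x) (hpos : 0 < M f) :
    ∃ k : G, ∀ O : Set (G ⧸ N), IsOpen O → (k : G ⧸ N) ∈ O →
      0 < M (((↑) : G → G ⧸ N) ⁻¹' O |>.indicator f) := by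
  by_contra! hc
  choose O hO hkO hMO using hc
  obtain ⟨t, ht⟩ := isCompact_univ.elim_finite_subcover O hO fun q _ => by
    obtain ⟨k, rfl⟩ := QuotientGroup.mk_surjective q
    exact Set.mem_iUnion.2 ⟨k, hkO k⟩
  have hind : ∀ k, IsBddMeasurable ((((↑) : G → G ⧸ N) ⁻¹' O k).indicator f) := fun k =>
    hf.indicator ((hO k).preimage QuotientGroup.continuous_mk).measurableSet
  have h1 : M f ≤ M fun x => ∑ k ∈ t, (((↑) : G → G ⧸ N) ⁻¹' O k).indicator f x := by
    refine M.mono hf (IsBddMeasurable.sum t fun k _ => hind k) fun x => ?_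
    obtain ⟨k, hk, hxk⟩ := Set.mem_iUnion₂.1 (ht (Set.mem_univ (x : G ⧸ N)))
    have hnn : ∀ i ∈ t, 0 ≤ (((↑) : G → G ⧸ N) ⁻¹' O i).indicator f x := fun i _ =>
      Set.indicator_nonneg (fun x _ => h0 x) x
    refine le_trans ?_ (Finset.single_le_sum hnn hk)
    rw [Set.indicator_of_mem (show x ∈ ((↑) : G → G ⧸ N) ⁻¹' O k from hxk)]
  rw [M.sum t fun k _ => hind k] at h1
  exact absurd (hpos.trans_le h1) (not_lt.2 (Finset.sum_nonpos fun k _ => hMO k))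

section Return

variable {G : Type*} [Group G] [TopologicalSpace G] [IsTopologicalGroup G] [MeasurableSpace G]
  [BorelSpace G] (M : BiinvariantMean G)

/-- The self-correlation `g ↦ M(f · f(g · ))` of a function of positive mean is positive on
average over any positive-density portion of a small enough neighbourhood of the von Neumann
kernel. In the representation attached to `M`, the component of `f` fixed by the kernel is nonzero,
as it pairs with the constants to `M f`, and its correlation is bounded below near the kernel by
continuity; the orthogonal component is weakly mixing and contributes nothing to the average. -/
theorem exists_nhds_mean_mul_correlation_pos {f : G → ℝ} (hf : f ∈ rucFunctions G)
    (hpos : 0 < M f) :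
    ∃ V : Set G, IsOpen V ∧ 1 ∈ V ∧ ∀ w : G → ℝ, IsBddMeasurable w → (∀ x, 0 ≤ w x) →
      (∀ x, w x ≠ 0 → ∃ v ∈ V, ∃ z ∈ vonNeumannKernel G, x = v * z) → 0 < M w →
      IsBddMeasurable (fun g => w g * M fun x => f x * f (g * x)) ∧
      0 < M fun g => w g * M fun x => f x * f (g * x) := by
  let ρ : G →* _ := PreGNS.rep (M := M)
  have hρ : IsOrthogonalRep ρ := PreGNS.isOrthogonalRep_rep
  let f' : PreGNS M := ⟨f, hf⟩
  let one' : PreGNS M := ⟨fun _ => 1, const_mem_rucFunctions 1⟩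
  let ξ : GNS M := f'
  let e : GNS M := one'
  have hφ : ∀ g, M (fun x => f x * f (g * x)) = inner ℝ ξ (ρ g ξ) := by
    intro g
    rw [real_inner_comm, hρ.inner_map_left, PreGNS.rep_coe, UniformSpace.Completion.inner_coe,
      PreGNS.inner_def]
    change _ = M fun x => f x * f (g⁻¹⁻¹ * x)
    rw [inv_inv]
  let K : Submodule ℝ (GNS M) :=
    ⨅ z : vonNeumannKernel G, LinearMap.eqLocus (ρ z).toLinearMap LinearMap.id
  have hK : ∀ y, y ∈ K ↔ ∀ z ∈ vonNeumannKernel G, ρ z y = y := fun y => by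
    simp only [K, Submodule.mem_iInf, LinearMap.mem_eqLocus, Subtype.forall]
    rfl
  have hKclosed : IsClosed (K : Set (GNS M)) := by
    have : (K : Set (GNS M)) =
        ⋂ z ∈ vonNeumannKernel G, {y | ρ z y = y} := by
      ext y
      simp [hK]
    rw [this]
    exact isClosed_biInter fun z _ => isClosed_eq (ρ z).continuous continuous_id
  have : CompleteSpace K := hKclosed.completeSpace_coe
  -- The fixed space of the kernel is invariant because the kernel is normal.
  have hKinv : ∀ g, ∀ y ∈ K, ρ g y ∈ K := fun g y hy => (hK _).2 fun z hz => by
    have h1 : g⁻¹ * z * g ∈ vonNeumannKernel G := by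
      simpa using (vonNeumannKernel_normal (G := G)).conj_mem z hz g⁻¹
    calc ρ z (ρ g y) = ρ g (ρ (g⁻¹ * z * g) y) := by
          rw [← rep_mul_apply ρ, ← rep_mul_apply ρ]; congr 2; group
      _ = ρ g y := by rw [(hK y).1 hy _ h1]
  let ξc := K.starProjection ξ
  let ξw := ξ - ξc
  have hξc : ξc ∈ K := K.starProjection_apply_mem ξ
  have hξw : ∀ y ∈ K, inner ℝ y ξw = 0 := fun y hy =>
    (Submodule.mem_orthogonal K _).1 (K.sub_starProjection_mem_orthogonal ξ) y hy
  have hξ : ξ = ξc + ξw := (add_sub_cancel ξc ξ).symm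
  have heK : e ∈ K := (hK e).2 fun z _ => by
    rw [PreGNS.rep_coe]; rfl
  have hξc0 : 0 < ‖ξc‖ := by
    refine norm_pos_iff.2 fun h0 => ?_
    have h1 : inner ℝ e ξ = M f := by
      rw [UniformSpace.Completion.inner_coe, PreGNS.inner_def]
      simp [one', f']
    rw [hξ, h0, zero_add, hξw e heK] at h1
    exact hpos.ne h1
  have hsplit : ∀ g, inner ℝ ξ (ρ g ξ) = inner ℝ ξc (ρ g ξc) + inner ℝ ξw (ρ g ξw) := by
    intro g
    have h1 : inner ℝ ξc (ρ g ξw) = 0 := by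
      rw [real_inner_comm, hρ.inner_map_left, real_inner_comm]
      exact hξw _ (hKinv _ _ hξc)
    have h2 : inner ℝ ξw (ρ g ξc) = 0 := by
      rw [real_inner_comm]
      exact hξw _ (hKinv _ _ hξc)
    rw [hξ, map_add, inner_add_left, inner_add_right, inner_add_right, h1, h2]
    ring
  have hw0 : M (fun g => |inner ℝ ξw (ρ g ξw)|) = 0 :=
    M.abs_eq_zero_of_sq_eq_zero (hρ.isBddMeasurable_inner _ _)
      (hρ.mean_inner_sq_eq_zero M (fun y hy => hξw y ((hK y).2 hy)) ξw)
  refine ⟨{v | ‖ρ v ξc - ξc‖ < ‖ξc‖ / 2}, ?_, ?_, fun w hw hw0' hwV hwpos => ?_⟩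
  · exact isOpen_lt ((hρ.continuous_apply ξc).sub continuous_const).norm continuous_const
  · change ‖ρ 1 ξc - ξc‖ < ‖ξc‖ / 2
    rw [map_one]
    simpa using half_pos hξc0
  simp only [hφ]
  have hbm := hw.mul (hρ.isBddMeasurable_inner ξ ξ)
  refine ⟨hbm, ?_⟩
  obtain ⟨C, hC⟩ := hw.2
  have hwm := (hρ.isBddMeasurable_inner ξw ξw).abs
  have hlow : M (fun g => ‖ξc‖ ^ 2 / 2 * w g - C * |inner ℝ ξw (ρ g ξw)|) ≤
      M fun g => w g * inner ℝ ξ (ρ g ξ) := by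
    refine M.mono ((hw.const_mul _).sub (hwm.const_mul _)) hbm fun g => ?_
    rw [hsplit, mul_add]
    have h1 : -(C * |inner ℝ ξw (ρ g ξw)|) ≤ w g * inner ℝ ξw (ρ g ξw) := by
      refine neg_le_of_abs_le ?_
      rw [abs_mul]
      exact mul_le_mul_of_nonneg_right (hC g) (abs_nonneg _)
    have h2 : ‖ξc‖ ^ 2 / 2 * w g ≤ w g * inner ℝ ξc (ρ g ξc) := by
      rcases eq_or_ne (w g) 0 with h0 | h0
      · simp [h0]
      obtain ⟨v, hv, z, hz, rfl⟩ := hwV g h0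
      rw [rep_mul_apply ρ, (hK ξc).1 hξc z hz, mul_comm]
      refine mul_le_mul_of_nonneg_left ?_ (hw0' _)
      have h3 : inner ℝ ξc (ρ v ξc) = ‖ξc‖ ^ 2 + inner ℝ ξc (ρ v ξc - ξc) := by
        rw [inner_sub_right, real_inner_self_eq_norm_sq]; ring
      have h4 := (abs_le.1 (abs_real_inner_le_norm ξc (ρ v ξc - ξc))).1
      have h5 : ‖ξc‖ * ‖ρ v ξc - ξc‖ ≤ ‖ξc‖ * (‖ξc‖ / 2) :=
        mul_le_mul_of_nonneg_left (le_of_lt hv) (norm_nonneg _)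
      rw [h3]
      nlinarith
    linarith
  rw [M.sub (hw.const_mul _) (hwm.const_mul _), M.const_mul' _ _ hw, M.const_mul' _ _ hwm, hw0,
    mul_zero, sub_zero] at hlow
  exact lt_of_lt_of_le (by positivity) hlow

variable [CompactSpace (G ⧸ vonNeumannKernel G)] [T2Space G] [NoncompactSpace G]

/-- The inductive step: given a function `f` of positive mean supported close enough to the von
Neumann kernel, there is `g`, outside a given compact set, which lies in the support of `f`
thickened on the right, and for which `f · f(g · )` still has positive mean. -/
theorem exists_mem_support_mul_correlation_pos {U U₁ : Set G} (hU₁ : IsOpen U₁)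
    (hone : 1 ∈ U₁) (hUU : ∀ a ∈ U₁, ∀ b ∈ U₁, ∀ c ∈ U₁, b⁻¹ * a⁻¹ * c ∈ U)
    {f : G → ℝ} (hf : f ∈ rucFunctions G) (h0 : ∀ x, 0 ≤ f x) (hpos : 0 < M f)
    (hsupp : ∀ x, 0 < f x → ∃ a ∈ U₁, ∃ b ∈ U₁, ∃ z ∈ vonNeumannKernel G, x = a * b * z)
    {C : Set G} (hC : IsCompact C) :
    ∃ g ∉ C, (∃ x, 0 < f x ∧ ∃ u ∈ U, g = x * u) ∧ 0 < M fun x => f x * f (g * x) := by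
  have hfb := isBddMeasurable_of_mem_rucFunctions hf
  obtain ⟨V, hV, hV1, hVw⟩ := exists_nhds_mean_mul_correlation_pos M hf hpos
  obtain ⟨k, hk⟩ := exists_forall_mean_indicator_pos M (vonNeumannKernel G) hfb h0 hpos
  have himg : ∀ (A : Set G) (l : G), IsOpen A → IsOpen (((↑) : G → G ⧸ vonNeumannKernel G) ''
      ((fun x => x * l) '' A)) := fun A l hA =>
    QuotientGroup.isOpenMap_coe _ (isOpenMap_mul_right l _ hA)
  -- The concentration point `k` can be represented by an element whose inverse lies in `U`.
  obtain ⟨l, hlU, hlk⟩ : ∃ l : G, l⁻¹ ∈ U ∧ (l : G ⧸ vonNeumannKernel G) = k := by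
    have h1 := hk _ (himg U₁ k hU₁) ⟨k, ⟨1, hone, one_mul k⟩, rfl⟩
    obtain ⟨x, hx⟩ := M.exists_pos (hfb.indicator
      ((himg U₁ k hU₁).preimage QuotientGroup.continuous_mk).measurableSet) h1
    have hxO := Set.mem_of_indicator_ne_zero hx.ne'
    rw [Set.indicator_of_mem hxO] at hx
    obtain ⟨a, ha, b, hb, z, hz, hxabz⟩ := hsupp x hx
    obtain ⟨_, ⟨c, hc, rfl⟩, hcx⟩ := hxO
    refine ⟨c⁻¹ * (a * b), by simpa [mul_assoc] using hUU a ha b hb c hc, ?_⟩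
    rw [QuotientGroup.eq] at hcx ⊢
    have h2 := (vonNeumannKernel G).mul_mem hz ((vonNeumannKernel G).inv_mem hcx)
    convert h2 using 1
    rw [hxabz]
    group
  have hO := himg V l hV
  have hOm := (hO.preimage QuotientGroup.continuous_mk).measurableSet
  let w₀ : G → ℝ := fun x => (((↑) : G → G ⧸ vonNeumannKernel G) ⁻¹'
    (((↑) : G → G ⧸ vonNeumannKernel G) '' ((fun x => x * l) '' V))).indicator f (x * l)
  have hw₀ : IsBddMeasurable w₀ := (hfb.indicator hOm).comp (measurable_mul_const l)
  have hw₀pos : 0 < M w₀ := by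
    rw [M.right' l _ (hfb.indicator hOm)]
    exact hk _ hO ⟨l, ⟨1, hV1, one_mul l⟩, hlk⟩
  have hw₀nn : ∀ x, 0 ≤ w₀ x := fun x => Set.indicator_nonneg (fun x _ => h0 x) _
  have hCm := hC.isClosed.measurableSet
  -- Removing a compact set does not change the mean.
  have hwC : 0 < M (Cᶜ.indicator w₀) := by
    obtain ⟨B, hB⟩ := hw₀.2
    have h1 : M (C.indicator w₀) ≤ M fun x => B * C.indicator (fun _ => 1) x := by
      refine M.mono (hw₀.indicator hCm)
        (((IsBddMeasurable.const 1).indicator hCm).const_mul B) fun x => ?_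
      by_cases hx : x ∈ C
      · simpa [hx] using (le_abs_self _).trans (hB x)
      · simp [hx]
    rw [M.const_mul' _ _ ((IsBddMeasurable.const 1).indicator hCm),
      M.indicator_compact_eq_zero hC, mul_zero] at h1
    have h2 := M.add' _ _ (hw₀.indicator hCm) (hw₀.indicator hCm.compl)
    have h3 : (fun x => C.indicator w₀ x + Cᶜ.indicator w₀ x) = w₀ :=
      Set.indicator_self_add_compl C w₀
    rw [h3] at h2
    linarith
  obtain ⟨hbm, hmean⟩ := hVw (Cᶜ.indicator w₀) (hw₀.indicator hCm.compl)
    (fun x => Set.indicator_nonneg (fun x _ => hw₀nn x) x)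
    (fun x hx => by
      have hx1 : w₀ x ≠ 0 := fun h => hx (by by_cases hxC : x ∈ Cᶜ <;> simp [h])
      obtain ⟨_, ⟨v, hv, rfl⟩, hvx⟩ := Set.mem_of_indicator_ne_zero hx1
      rw [QuotientGroup.eq] at hvx
      refine ⟨v, hv, l * ((v * l)⁻¹ * (x * l)) * l⁻¹,
        (vonNeumannKernel_normal (G := G)).conj_mem _ hvx l, by group⟩) hwC
  obtain ⟨g, hg⟩ := M.exists_pos hbm hmean
  have hcorr : 0 ≤ M fun x => f x * f (g * x) :=
    M.nonneg' _ (hfb.mul (hfb.comp (measurable_const_mul g))) fun x => mul_nonneg (h0 _) (h0 _)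
  have hgw := pos_of_mul_pos_left hg hcorr
  have hgC : g ∈ Cᶜ := Set.mem_of_indicator_ne_zero hgw.ne'
  rw [Set.indicator_of_mem hgC] at hgw
  refine ⟨g, hgC, ⟨g * l, ?_, l⁻¹, hlU, by group⟩, pos_of_mul_pos_right hg ?_⟩
  · have := Set.mem_of_indicator_ne_zero hgw.ne'
    rwa [show w₀ g = f (g * l) from Set.indicator_of_mem this f] at hgw
  · exact Set.indicator_nonneg (fun x _ => hw₀nn x) g

end Return

/-! ### Construction of increasing finite products -/

section Construction

variable {G : Type*} [Group G]

theorem increasingProduct_insert (g : ℕ → G) {n : ℕ} {α : Finset ℕ} (hα : ∀ i ∈ α, i < n) :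
    increasingProduct g (insert n α) = increasingProduct g α * g n := by
  have hn : n ∉ α := fun h => (hα n h).false
  have hnd : (α.sort (· ≤ ·) ++ [n]).Nodup := by
    simpa [List.nodup_append, Finset.sort_nodup] using hn
  have hsort : (insert n α).sort (· ≤ ·) = α.sort (· ≤ ·) ++ [n] := by
    have := (List.toFinset_sort (· ≤ ·) hnd).2 (by
      rw [List.pairwise_append]
      exact ⟨Finset.pairwise_sort _ _, List.pairwise_singleton _ _, by
        simpa using fun i hi => (hα i hi).le⟩)
    rw [← this]
    congr 1
    ext i
    simp
  simp [increasingProduct, hsort]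

variable [TopologicalSpace G] [IsTopologicalGroup G] [MeasurableSpace G]
  [BorelSpace G] (M : BiinvariantMean G) [CompactSpace (G ⧸ vonNeumannKernel G)] [T2Space G]
  [LocallyCompactSpace G] [SecondCountableTopology G] [NoncompactSpace G]

/-- A set of positive mean close to the von Neumann kernel, thickened on both sides, contains an
increasing finite products set. The sequence `g` is built with functions `f n` of positive mean
such that `f (n + 1) = f n · f n (g n · )`, where `g n` lies in the support of `f n` thickened on
the right. Only the thickening on the right enters this recursion, and it is the same `U` at every
stage; a thickening on the left would have to be conjugated by the `g n` and might shrink. -/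
theorem exists_increasingProducts_of_mean_pos {U : Set G} (hU : U ∈ 𝓝 1) :
    ∃ U₁ : Set G, IsOpen U₁ ∧ 1 ∈ U₁ ∧ ∀ W : Set G, MeasurableSet W →
      (∀ x ∈ W, ∃ u ∈ U₁, ∃ z ∈ vonNeumannKernel G, x = u * z) →
      0 < M (W.indicator fun _ => 1) → ∃ P, IsIncreasingFiniteProductsSet P ∧ P ⊆ U * W * U := by
  obtain ⟨V₁, hV₁o, hV₁1, hV₁⟩ := exists_open_nhds_one_mul_subset hU
  obtain ⟨V₂, hV₂o, hV₂1, hV₂⟩ := exists_open_nhds_one_mul_subset (hV₁o.mem_nhds hV₁1)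
  have hUU : ∀ a ∈ V₂ ∩ V₂⁻¹, ∀ b ∈ V₂ ∩ V₂⁻¹, ∀ c ∈ V₂ ∩ V₂⁻¹, b⁻¹ * a⁻¹ * c ∈ U :=
    fun a ha b hb c hc => hV₁ (Set.mul_mem_mul (hV₂ (Set.mul_mem_mul hb.2 ha.2))
      (hV₂ ⟨c, hc.1, 1, hV₂1, mul_one c⟩))
  have hU₁o : IsOpen (V₂ ∩ V₂⁻¹) := hV₂o.inter hV₂o.inv
  have hU₁1 : (1 : G) ∈ V₂ ∩ V₂⁻¹ := ⟨hV₂1, by simpa using hV₂1⟩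
  refine ⟨V₂ ∩ V₂⁻¹, hU₁o, hU₁1, fun W hW hWN hWpos => ?_⟩
  obtain ⟨F, hF, hF0, hFW, hFsupp⟩ := exists_ruc_thickening W (hU₁o.mem_nhds hU₁1)
  let Q : (G → ℝ) → Prop := fun f => f ∈ rucFunctions G ∧ (∀ x, 0 ≤ f x) ∧ 0 < M f ∧
    ∀ x, 0 < f x → 0 < F x
  have hFM : 0 < M F := by
    refine hWpos.trans_le (M.mono ((IsBddMeasurable.const 1).indicator hW)
      (isBddMeasurable_of_mem_rucFunctions hF) fun x => ?_)
    by_cases hx : x ∈ W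
    · simpa [hx] using hFW x hx
    · simpa [hx] using hF0 x
  let E : CompactExhaustion G := default
  have hstep : ∀ (f : {f // Q f}) (n : ℕ), ∃ g ∉ E n, (∃ x, 0 < f.1 x ∧ ∃ u ∈ U, g = x * u) ∧
      Q fun x => f.1 x * f.1 (g * x) := by
    rintro ⟨f, hf, hf0, hfpos, hfF⟩ n
    obtain ⟨g, hgE, hgx, hgpos⟩ := exists_mem_support_mul_correlation_pos M hU₁o hU₁1 hUU hf hf0
      hfpos (fun x hx => by
        obtain ⟨a, ha, y, hy, rfl⟩ := hFsupp x (hfF x hx)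
        obtain ⟨b, hb, z, hz, rfl⟩ := hWN y hy
        exact ⟨a, ha, b, hb, z, hz, (mul_assoc _ _ _).symm⟩) (E.isCompact n)
    exact ⟨g, hgE, hgx, mul_mem_rucFunctions hf (comp_mul_left_mem_rucFunctions hf g),
      fun x => mul_nonneg (hf0 _) (hf0 _), hgpos,
      fun x hx => hfF x (pos_of_mul_pos_left hx (hf0 _))⟩
  choose γ hγE hγx hγQ using hstep
  let f : ℕ → {f // Q f} := fun n =>
    Nat.rec ⟨F, hF, hF0, hFM, fun _ h => h⟩ (fun n fn => ⟨_, hγQ fn n⟩) n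
  let g : ℕ → G := fun n => γ (f n) n
  have hfsucc : ∀ n x, (f (n + 1)).1 x = (f n).1 x * (f n).1 (g n * x) := fun n x => rfl
  have hprod : ∀ n x, 0 < (f n).1 x → ∀ α : Finset ℕ, (∀ i ∈ α, i < n) →
      0 < F (increasingProduct g α * x) := by
    intro n
    induction n with
    | zero =>
      intro x hx α hα
      have : α = ∅ := Finset.eq_empty_of_forall_notMem fun i hi => absurd (hα i hi) (by simp)
      subst this
      have hx' : 0 < F x := hx
      simpa [increasingProduct] using hx'
    | succ n ih =>
      intro x hx α hα
      rw [hfsucc] at hx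
      have h1 := pos_of_mul_pos_left hx ((f n).2.2.1 _)
      have h2 := pos_of_mul_pos_right hx ((f n).2.2.1 _)
      have herase : ∀ i ∈ α.erase n, i < n := fun i hi =>
        lt_of_le_of_ne (Nat.lt_succ_iff.1 (hα i (Finset.mem_of_mem_erase hi)))
          (Finset.ne_of_mem_erase hi)
      by_cases hn : n ∈ α
      · rw [← Finset.insert_erase hn, increasingProduct_insert g herase, mul_assoc]
        exact ih _ h2 _ herase
      · exact ih x h1 α fun i hi => herase i (by rwa [Finset.erase_eq_of_notMem hn])
  refine ⟨_, ⟨g, ?_, rfl⟩, ?_⟩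
  · refine (hasBasis_cocompact.tendsto_right_iff).2 fun C hC => ?_
    obtain ⟨n, hn⟩ := E.exists_superset_of_isCompact hC
    filter_upwards [eventually_ge_atTop n] with i hi hiC
    exact hγE (f i) i (E.subset hi (hn hiC))
  · rintro _ ⟨α, hα, rfl⟩
    have hmax := α.max'_mem hα
    have herase : ∀ i ∈ α.erase (α.max' hα), i < α.max' hα := fun i hi =>
      lt_of_le_of_ne (α.le_max' i (Finset.mem_of_mem_erase hi)) (Finset.ne_of_mem_erase hi)
    obtain ⟨x, hx, u, hu, hgx⟩ := hγx (f (α.max' hα)) (α.max' hα)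
    rw [← Finset.insert_erase hmax, increasingProduct_insert g herase]
    change _ * γ (f (α.max' hα)) (α.max' hα) ∈ _
    rw [hgx, ← mul_assoc]
    obtain ⟨a, ha, y, hy, hay⟩ := hFsupp _ (hprod _ x hx _ herase)
    refine Set.mul_mem_mul ⟨a, ?_, y, hy, hay⟩ hu
    simpa using hUU 1 hU₁1 1 hU₁1 a ha

end Construction

end FiniteProducts

theorem mainTheorem5 {G : Type*} [Group G] [TopologicalSpace G] [IsTopologicalGroup G]
    [T2Space G] [LocallyCompactSpace G] [SecondCountableTopology G] [NoncompactSpace G]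
    [MeasurableSpace G] [BorelSpace G] (m : Measure G) [m.IsHaarMeasure]
    (hamen : FiniteProducts.IsAmenable m)
    (hcocompact : CompactSpace (G ⧸ FiniteProducts.vonNeumannKernel G))
    (S : Set G) (hS : FiniteProducts.IsSubstantial m S) :
    (∃ (a : G) (P : Set G), FiniteProducts.IsIncreasingFiniteProductsSet P ∧
      (fun x => a * x) '' P ⊆ S) ∧
    (∃ (a : G) (P : Set G), FiniteProducts.IsIncreasingFiniteProductsSet P ∧
      (fun x => x * a) '' P ⊆ S) := by
  obtain ⟨W, U, Φ, hW, hΦ, hpos, hUo, -, hU1, hUS⟩ := hS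
  obtain ⟨M, hM⟩ := FiniteProducts.exists_mean_pos hΦ hW hpos
  have hbW : FiniteProducts.IsBddMeasurable (W.indicator fun _ => (1 : ℝ)) :=
    (FiniteProducts.IsBddMeasurable.const 1).indicator hW
  -- `W` has positive mean near every neighbourhood of some coset `k G₀ = G₀ k`.
  obtain ⟨k, hk⟩ := FiniteProducts.exists_forall_mean_indicator_pos M
    (FiniteProducts.vonNeumannKernel G) hbW
    (fun x => Set.indicator_nonneg (by simp) x) hM
  have hUn : U ∈ 𝓝 (1 : G) := hUo.mem_nhds hU1
  constructor
  · -- The left translate `k⁻¹ W` is thickened on the left by `k⁻¹ U k`.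
    have hU' : U ∩ (fun x => k * x * k⁻¹) ⁻¹' U ∈ 𝓝 (1 : G) :=
      inter_mem hUn ((show Continuous fun x : G => k * x * k⁻¹ by fun_prop).continuousAt
        (by simpa using hUn))
    obtain ⟨U₁, hU₁o, hU₁1, hcore⟩ :=
      FiniteProducts.exists_increasingProducts_of_mean_pos M hU'
    have hO : IsOpen (((↑) : G → G ⧸ FiniteProducts.vonNeumannKernel G) ''
        ((fun x => k * x) '' U₁)) :=
      QuotientGroup.isOpenMap_coe _ (isOpenMap_mul_left k _ hU₁o)
    have hOm := (hO.preimage QuotientGroup.continuous_mk).measurableSet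
    obtain ⟨P, hP, hPU⟩ := hcore ((fun x => k * x) ⁻¹' 
      ((((↑) : G → G ⧸ FiniteProducts.vonNeumannKernel G) ⁻¹' _) ∩ W))
      ((measurable_const_mul k) (hOm.inter hW))
      (fun x hx => by
        obtain ⟨⟨_, ⟨u, hu, rfl⟩, hux⟩, -⟩ := hx
        exact ⟨u, hu, _, QuotientGroup.eq.1 hux, by simp only; group⟩)
      (by
        have h1 := hk _ hO ⟨k, ⟨1, hU₁1, mul_one k⟩, rfl⟩
        rw [← M.left' k _ (hbW.indicator hOm)] at h1
        rw [Set.indicator_indicator] at h1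
        exact h1)
    refine ⟨k, P, hP, ?_⟩
    rintro _ ⟨x, hx, rfl⟩
    obtain ⟨_, ⟨a, ha, y, hy, rfl⟩, b, hb, rfl⟩ := hPU hx
    refine hUS ⟨(k * a * k⁻¹) * (k * y), Set.mul_mem_mul ha.2 hy.2, b, hb.1, ?_⟩
    simp only
    group
  · -- The right translate `W k⁻¹` is thickened on the right by `k U k⁻¹`.
    have hU' : U ∩ (fun x => k⁻¹ * x * k) ⁻¹' U ∈ 𝓝 (1 : G) :=
      inter_mem hUn ((show Continuous fun x : G => k⁻¹ * x * k by fun_prop).continuousAt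
        (by simpa using hUn))
    obtain ⟨U₁, hU₁o, hU₁1, hcore⟩ :=
      FiniteProducts.exists_increasingProducts_of_mean_pos M hU'
    have hO : IsOpen (((↑) : G → G ⧸ FiniteProducts.vonNeumannKernel G) ''
        ((fun x => x * k) '' U₁)) :=
      QuotientGroup.isOpenMap_coe _ (isOpenMap_mul_right k _ hU₁o)
    have hOm := (hO.preimage QuotientGroup.continuous_mk).measurableSet
    obtain ⟨P, hP, hPU⟩ := hcore ((fun x => x * k) ⁻¹' 
      ((((↑) : G → G ⧸ FiniteProducts.vonNeumannKernel G) ⁻¹' _) ∩ W))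
      ((measurable_mul_const k) (hOm.inter hW))
      (fun x hx => by
        obtain ⟨⟨_, ⟨u, hu, rfl⟩, hux⟩, -⟩ := hx
        refine ⟨u, hu, _, FiniteProducts.vonNeumannKernel_normal.conj_mem _
          (QuotientGroup.eq.1 hux) k, by simp only; group⟩)
      (by
        have h1 := hk _ hO ⟨k, ⟨1, hU₁1, one_mul k⟩, rfl⟩
        rw [← M.right' k _ (hbW.indicator hOm)] at h1
        rw [Set.indicator_indicator] at h1
        exact h1)
    refine ⟨k, P, hP, ?_⟩
    rintro _ ⟨x, hx, rfl⟩
    obtain ⟨_, ⟨a, ha, y, hy, rfl⟩, b, hb, rfl⟩ := hPU hx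
    refine hUS ⟨a * (y * k), Set.mul_mem_mul ha.1 hy.2, k⁻¹ * b * k, hb.2, ?_⟩
    simp only
    group
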